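/- Let $\mathbb{R}_{\ge0}=[0,\infty)$. A function $\rho:\mathbb{R}_{\ge0}\to\mathbb{R}_{\ge0}$ is of class $\mathcal{K}_\infty$ if it is continuous, strictly increasing and unbounded with $\rho(0)=0$. A continuous function $\beta:\mathbb{R}_{\ge0}\times\mathbb{R}_{\ge0}\to\mathbb{R}_{\ge0}$ is of class $\mathcal{KL}_0$ if $\lim_{t\to\infty}\beta(r,t)=0$ for each $r>0$ and, for each $t\ge0$, either $\beta(\cdot,t)\in\mathcal{K}_\infty$ or $\beta(\cdot,t)\equiv0$. Let $\omega\ge1$ and $\beta\in\mathcal{KL}_0$. Call $\beta$ *exponential* if $\beta(r,n)=C\sigma^n r$ for all $r\ge0$, $n\in\mathbb{N}_0$, with constants $C\ge1$, $\sigma\in(0,1)$, and *finite-time* if $\beta(r,n)=c_nr$ for all $r\ge0$, $n\in\mathbb{N}_0$, with $c_n\ge0$ and $c_n=0$ for all sufficiently large $n$. For $k\ge1$ put $B_k(r)=\sum_{n=0}^{k-2}\beta(r,n)+\omega\beta(r,k-1)$. For $m\ge 1$ and $N\ge m+1$ let $$\alpha_{N,m}^\omega=\inf\frac{\sum_{n=0}^{N-2}\lambda_n+\omega\lambda_{N-1}-\nu}{\sum_{n=0}^{m-1}\lambda_n}\in[-\infty,+\infty],$$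 the infimum being over all $\lambda_0,\dots,\lambda_{N-1},\nu>0$ with $$\sum_{n=k}^{N-2}\lambda_n+\omega\lambda_{N-1}\le B_{N-k}(\lambda_k)\quad(0\le k\le N-2),\qquad \nu\le\sum_{n=0}^{j-1}\lambda_{n+m}+B_{N-j}(\lambda_{j+m})\quad(0\le j\le N-m-1),$$ and $\inf\emptyset=+\infty$. **(a)** Suppose that $\beta$ is exponential, or that $\beta$ is finite-time and $B_k(1)>1$ for all $k\ge2$ (for finite-time $\beta$, this says exactly that the constraints can be met for all $N\ge m+1$; it holds, for instance, if $c_0>1$, or if $c_0=1$ and $c_1>0$). Then for each fixed $m\ge1$, $\lim_{N\to\infty}\alpha_{N,m}^\omega=1$. **(b)** Suppose that $\beta$ is exponential or finite-time, and let $m^\star\ge1$ and $M\subseteq\{1,\dots,m^\star\}$. Then there is $N_0$, depending only on $\beta,\omega,m^\star,M$, such that for every $N\ge N_0$ one has $N\ge m^\star+1$, $\alpha_{N,m}^\omega>0$ for all $m\in M$, and the following stability property holds. Let $X,U$ be metric spaces, $f:X\times U\to X$, $l:X\times U\to\mathbb{R}_{\ge0}$, and write $x_u$ for the solution of $x_u(n+1)=f(x_u(n),u(n))$,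 $x_u(0)=x_0$, and $l^\star(x)=\inf_{u\in U}l(x,u)$. Assume: * for each $x_0\in X$ there is $u:\mathbb{N}_0\to U$ with $l(x_u(n),u(n))\le\beta(l^\star(x_0),n)$ for all $n\in\mathbb{N}_0$; * $A\subseteq X$ is a nonempty closed set such that for each $x\in A$ there is $u\in U$ with $f(x,u)\in A$ and $l(x,u)=0$, and there are $\alpha_1,\alpha_2\in\mathcal{K}_\infty$ with $\alpha_1(\|x\|_A)\le l^\star(x)\le\alpha_2(\|x\|_A)$ for all $x\in X$, where $\|x\|_A$ is the distance from $x$ to $A$; * $\mu$ is a multistep MPC feedback law with optimization horizon $N$: for each $x_0\in X$, the values $\mu(x_0,0),\dots,\mu(x_0,m^\star-1)$ are the first $m^\star$ elements of a control sequence minimizing $J_N(x_0,u)=\sum_{n=0}^{N-2}l(x_u(n),u(n))+\omega\, l(x_u(N-1),u(N-1))$ over all $u:\mathbb{N}_0\to U$. Then $\mu$ asymptotically stabilizes $A$: there is $\tilde\beta\in\mathcal{KL}_0$ such that for every sequence $(m_i)_{i\in\mathbb{N}_0}$ in $M$ and every closed-loop trajectory $$x(n+1)=f\bigl(x(n),\mu(x(\varphi(n)),n-\varphi(n))\bigr),\qquad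 \varphi(n)=\max\Bigl\{\textstyle\sum_{j<k}m_j : k\in\mathbb{N}_0,\ \sum_{j<k}m_j\le n\Bigr\},$$ one has $\|x(n)\|_A\le\tilde\beta(\|x(0)\|_A,n)$ for all $n\in\mathbb{N}_0$. -/

import Mathlib

open Filter Topology
open scoped NNReal

universe u v

namespace MPC

/-- Class `K_∞`: continuous, zero at zero, strictly increasing and unbounded functions
on the nonnegative reals. -/
def IsKInfty (ρ : ℝ≥0 → ℝ≥0) : Prop :=
  Continuous ρ ∧ ρ 0 = 0 ∧ StrictMono ρ ∧ ¬ BddAbove (Set.range ρ)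

/-- Class `KL_0`: jointly continuous `β`, with `β(r, t) → 0` as `t → ∞` for every `r > 0`, and such
that for every `t` the function `β(·, t)` is of class `K_∞` or identically zero. -/
def IsKL0 (β : ℝ≥0 → ℝ≥0 → ℝ≥0) : Prop :=
  Continuous (fun p : ℝ≥0 × ℝ≥0 => β p.1 p.2) ∧
  (∀ r, 0 < r → Tendsto (fun t => β r t) atTop (𝓝 0)) ∧
  (∀ t, IsKInfty (fun r => β r t) ∨ ∀ r, β r t = 0)

/-- Exponential controllability: `β(r, n) = C σ^n r` with `C ≥ 1` and `0 < σ < 1`. -/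
def IsExponential (β : ℝ≥0 → ℝ≥0 → ℝ≥0) : Prop :=
  ∃ C σ : ℝ≥0, 1 ≤ C ∧ 0 < σ ∧ σ < 1 ∧ ∀ (r : ℝ≥0) (n : ℕ), β r n = C * σ ^ n * r

/-- Finite time controllability: `β(r, n) = c_n r` with `c_n ≥ 0` and `c_n = 0` from some index
on. -/
def IsFiniteTime (β : ℝ≥0 → ℝ≥0 → ℝ≥0) : Prop :=
  ∃ c : ℕ → ℝ≥0, (∃ n₀ : ℕ, ∀ n, n₀ ≤ n → c n = 0) ∧ ∀ (r : ℝ≥0) (n : ℕ), β r n = c n * r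

/-- `B_N(r) = ∑_{n=0}^{N-2} β(r, n) + ω β(r, N-1)`, for `N ≥ 1`. -/
def B (β : ℝ≥0 → ℝ≥0 → ℝ≥0) (ω : ℝ≥0) (N : ℕ) (r : ℝ≥0) : ℝ≥0 :=
  ∑ n ∈ Finset.range (N - 1), β r n + ω * β r ((N - 1 : ℕ) : ℝ≥0)

/-- The constraints of the optimization problem in `lam 0, …, lam (N-1)` and `ν` with optimization
horizon `N`, control horizon `m` and terminal weight `ω`. The entries `lam n`, `n ≥ N`,
play no role. -/
def Feasible (β : ℝ≥0 → ℝ≥0 → ℝ≥0) (ω : ℝ≥0) (N m : ℕ) (lam : ℕ → ℝ≥0) (ν : ℝ≥0) : Prop :=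
  (∀ n, n < N → 0 < lam n) ∧ 0 < ν ∧
  (∀ k, k + 2 ≤ N →
    ∑ n ∈ Finset.Ico k (N - 1), lam n + ω * lam (N - 1) ≤ B β ω (N - k) (lam k)) ∧
  (∀ j, j + m + 1 ≤ N →
    ν ≤ ∑ n ∈ Finset.range j, lam (n + m) + B β ω (N - j) (lam (j + m)))

/-- The optimal value `α_{N,m}^ω` of the optimization problem, as an extended real number
(so that an infimum over an empty feasible set is `+∞`). -/
noncomputable def alphaOpt (β : ℝ≥0 → ℝ≥0 → ℝ≥0) (ω : ℝ≥0) (N m : ℕ) : EReal :=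
  ⨅ (lam : ℕ → ℝ≥0) (ν : ℝ≥0) (_ : Feasible β ω N m lam ν),
    (((∑ n ∈ Finset.range (N - 1), (lam n : ℝ) + (ω : ℝ) * (lam (N - 1) : ℝ) - (ν : ℝ)) /
      ∑ n ∈ Finset.range m, (lam n : ℝ) : ℝ) : EReal)

section Systems

variable {X U : Type*}

/-- The trajectory `x_u` of `x(n+1) = f(x(n), u(n))`, `x(0) = x₀`. -/
def traj (f : X → U → X) (u : ℕ → U) (x₀ : X) : ℕ → X
  | 0 => x₀
  | n + 1 => f (traj f u x₀ n) (u n)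

/-- The finite horizon cost
`J_N(x₀, u) = ∑_{n=0}^{N-2} l(x_u(n), u(n)) + ω l(x_u(N-1), u(N-1))`, for `N ≥ 1`. -/
def cost (f : X → U → X) (l : X → U → ℝ≥0) (ω : ℝ≥0) (N : ℕ) (x₀ : X) (u : ℕ → U) : ℝ≥0 :=
  ∑ n ∈ Finset.range (N - 1), l (traj f u x₀ n) (u n)
    + ω * l (traj f u x₀ (N - 1)) (u (N - 1))

/-- `l⋆(x)`, the infimum of `l(x, u)` over all control values `u`. -/
noncomputable def lstar (l : X → U → ℝ≥0) (x : X) : ℝ≥0 := ⨅ u, l x u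

/-- The controllability assumption: from each `x₀` some control sequence satisfies
`l(x_u(n), u(n)) ≤ β(l⋆(x₀), n)` for all `n`. -/
def Controllable (f : X → U → X) (l : X → U → ℝ≥0) (β : ℝ≥0 → ℝ≥0 → ℝ≥0) : Prop :=
  ∀ x₀ : X, ∃ u : ℕ → U, ∀ n : ℕ, l (traj f u x₀ n) (u n) ≤ β (lstar l x₀) n

/-- The assumption on the set `A` to be stabilized: `A` is closed (and nonempty), can be kept
forever at zero cost, and `l⋆` is bounded below and above by `K_∞`-functions of the distance
to `A`. -/
def TargetSet [MetricSpace X] (f : X → U → X) (l : X → U → ℝ≥0) (A : Set X) : Prop :=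
  IsClosed A ∧ A.Nonempty ∧
  (∀ x ∈ A, ∃ u : U, f x u ∈ A ∧ l x u = 0) ∧
  (∃ α₁ α₂ : ℝ≥0 → ℝ≥0, IsKInfty α₁ ∧ IsKInfty α₂ ∧
    ∀ x : X, α₁ (Metric.infNndist x A) ≤ lstar l x ∧ lstar l x ≤ α₂ (Metric.infNndist x A))

/-- The transmission times `σ(k) = m_0 + … + m_{k-1}` of a control horizon sequence. -/
def sigma (m : ℕ → ℕ) (k : ℕ) : ℕ := ∑ j ∈ Finset.range k, m j

/-- `φ(n) = max {σ(k) | σ(k) ≤ n}`, the last transmission time not after `n`. -/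
noncomputable def phi (m : ℕ → ℕ) (n : ℕ) : ℕ := sSup {s : ℕ | (∃ k, s = sigma m k) ∧ s ≤ n}

/-- `x` is a closed loop trajectory of the multistep feedback law `μ` with control horizon sequence
`m`: `x(n+1) = f(x(n), μ(x(φ(n)), n - φ(n)))`. When all control horizons are at most `mstar`, only
the values `μ y n` with `n < mstar` are used. -/
def IsClosedLoop (f : X → U → X) (μ : X → ℕ → U) (m : ℕ → ℕ) (x : ℕ → X) : Prop :=
  ∀ n, x (n + 1) = f (x n) (μ (x (phi m n)) (n - phi m n))

/-- `μ` is a multistep MPC feedback law with optimization horizon `N` and maximal control horizon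
`mstar`: for each `x₀` the values `μ x₀ 0, …, μ x₀ (mstar - 1)` are the first elements of a
control sequence which minimizes `J_N(x₀, ·)`. -/
def IsMPCFeedback (f : X → U → X) (l : X → U → ℝ≥0) (ω : ℝ≥0) (N mstar : ℕ)
    (μ : X → ℕ → U) : Prop :=
  ∀ x₀ : X, ∃ ustar : ℕ → U,
    (∀ u : ℕ → U, cost f l ω N x₀ ustar ≤ cost f l ω N x₀ u) ∧
    ∀ n, n < mstar → μ x₀ n = ustar n

/-- The multistep feedback law `μ` asymptotically stabilizes `A`: one `KL_0` function bounds the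
distance to `A` along the closed loop, for all initial values and all control horizon sequences
with values in `M`. -/
def AsymptoticallyStabilizes [MetricSpace X] (f : X → U → X) (μ : X → ℕ → U) (M : Set ℕ)
    (A : Set X) : Prop :=
  ∃ β' : ℝ≥0 → ℝ≥0 → ℝ≥0, IsKL0 β' ∧
    ∀ m : ℕ → ℕ, (∀ i, m i ∈ M) → ∀ x : ℕ → X, IsClosedLoop f μ m x →
      ∀ n : ℕ, Metric.infNndist (x n) A ≤ β' (Metric.infNndist (x 0) A) n

end Systems

end MPC

/-! Both kinds of `β` are linear in `r` with summable coefficients, so `B_k(r) ≤ Γ r` with one `Γ`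
for all `k`. The constraint `k = 0` then bounds the whole sum of the `λ_n` by `Γ λ_0`, however long
the horizon, while each constraint on `ν` bounds its excess over the tail of the cost by `Γ λ_i`.
Averaging over the `N - m - 1` indices `i` bounds the excess by `Γ² λ_0 / (N - m - 1)`
(`sub_tail_le`), hence `α ≥ 1 - Γ² / (N - m - 1)`. Rapidly decaying geometric sequences give `α ≤
1`.

For stability the averaging is applied directly to the stage costs of an optimal trajectory, with
`ν` the optimal value `m` steps later (`cost_decrease`). The optimal value then shrinks by a fixed
factor between transmission times, and it bounds `l⋆` in between. -/

namespace MPC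

/-! ### Uniform linear bounds on `B_k` -/

section Linear

variable {β : ℝ≥0 → ℝ≥0 → ℝ≥0} {ω : ℝ≥0} {c : ℕ → ℝ≥0}

theorem exists_summable_linear (h : IsExponential β ∨ IsFiniteTime β) :
    ∃ c : ℕ → ℝ≥0, Summable c ∧ ∀ (r : ℝ≥0) (n : ℕ), β r n = c n * r := by
  rcases h with ⟨C, σ, -, -, hσ, h⟩ | ⟨c, ⟨n₀, hn₀⟩, h⟩
  · exact ⟨fun n => C * σ ^ n, (NNReal.summable_geometric hσ).mul_left C, h⟩
  · refine ⟨c, summable_of_ne_finset_zero (s := Finset.range n₀) fun n hn => hn₀ n ?_, h⟩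
    simpa using hn

theorem B_eq_mul (hc : ∀ (r : ℝ≥0) (n : ℕ), β r n = c n * r) (k : ℕ) (r : ℝ≥0) :
    B β ω k r = B β ω k 1 * r := by
  simp only [B, hc, add_mul, Finset.sum_mul, mul_one, mul_assoc]

theorem B_le_tsum_mul (hs : Summable c) (hc : ∀ (r : ℝ≥0) (n : ℕ), β r n = c n * r)
    (k : ℕ) (r : ℝ≥0) : B β ω k r ≤ (1 + ω) * (∑' n, c n) * r := by
  have h1 : ∑ n ∈ Finset.range (k - 1), c n ≤ ∑' n, c n := hs.sum_le_tsum _ fun _ _ => zero_le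
  have h2 : c (k - 1) ≤ ∑' n, c n := hs.le_tsum _ fun _ _ => zero_le
  have : B β ω k r = (∑ n ∈ Finset.range (k - 1), c n + ω * c (k - 1)) * r := by
    simp only [B, hc, add_mul, Finset.sum_mul, mul_assoc]
  rw [this, add_mul 1 ω, one_mul]
  gcongr

/-- For exponential or finite time controllability the functions `B_k` have a common linear
upper bound. -/
theorem exists_B_le (h : IsExponential β ∨ IsFiniteTime β) (ω : ℝ≥0) :
    ∃ Γ : ℝ≥0, 1 ≤ Γ ∧ ∀ k r, B β ω k r ≤ Γ * r := by
  obtain ⟨c, hs, hc⟩ := exists_summable_linear h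
  -- `1 ≤ Γ` makes the later contraction factor `1 - 1 / (2Γ)` positive.
  refine ⟨max 1 ((1 + ω) * ∑' n, c n), le_max_left _ _, fun k r => ?_⟩
  refine (B_le_tsum_mul hs hc k r).trans ?_
  gcongr
  exact le_max_right _ _

/-- The term `n = 0`, present because `k ≥ 2`, already contributes `C ≥ 1`; the positive terminal
term makes the inequality strict. -/
theorem one_lt_B_of_isExponential (h : IsExponential β) (hω : 1 ≤ ω) {k : ℕ} (hk : 2 ≤ k) :
    1 < B β ω k 1 := by
  obtain ⟨C, σ, hC, hσ, -, h⟩ := h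
  have h0 : 1 ≤ ∑ n ∈ Finset.range (k - 1), β 1 n := by
    refine le_trans ?_ (Finset.single_le_sum (f := fun n : ℕ => β 1 n) (fun _ _ => zero_le)
      (Finset.mem_range.2 (show 0 < k - 1 by omega)))
    simpa only [h, pow_zero, mul_one] using hC
  have h1 : 0 < ω * β 1 ((k - 1 : ℕ) : ℝ≥0) := by
    rw [h]
    have := zero_lt_one.trans_le hC
    have := zero_lt_one.trans_le hω
    positivity
  exact (lt_add_of_pos_right 1 h1).trans_le (by unfold B; gcongr)

end Linear

/-! ### Two-sided bounds on the optimal value -/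

section OptimizationProblem

variable {β : ℝ≥0 → ℝ≥0 → ℝ≥0} {ω Γ : ℝ≥0} {N m : ℕ} {lam : ℕ → ℝ≥0} {ν : ℝ≥0}

/-- Averaging over the constraints on `ν`: it exceeds the tail of the cost by at most
`Γ² λ₀ / (N - m - 1)`. -/
theorem mul_sub_tail_le (hm : m + 2 ≤ N)
    (h0 : ∑ n ∈ Finset.Ico 0 (N - 1), lam n + ω * lam (N - 1) ≤ Γ * lam 0)
    (hν : ∀ j, j + m + 1 ≤ N → ν ≤ ∑ n ∈ Finset.range j, lam (n + m) + Γ * lam (j + m)) :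
    ((N : ℝ) - m - 1) * (ν - (∑ n ∈ Finset.Ico m (N - 1), (lam n : ℝ) + ω * lam (N - 1))) ≤
      Γ ^ 2 * lam 0 := by
  set D : ℝ := ν - (∑ n ∈ Finset.Ico m (N - 1), (lam n : ℝ) + ω * lam (N - 1)) with hD
  -- Take the constraint `j = i - m`: its partial sum is at most the full tail.
  have key : ∀ i ∈ Finset.Ico m (N - 1), D ≤ Γ * lam i := by
    intro i hi
    rw [Finset.mem_Ico] at hi
    have h1 : (ν : ℝ) ≤ ∑ n ∈ Finset.range (i - m), (lam (n + m) : ℝ) + Γ * lam i := by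
      have := hν (i - m) (by omega)
      rw [Nat.sub_add_cancel hi.1] at this
      exact_mod_cast this
    have h2 : ∑ n ∈ Finset.range (i - m), (lam (n + m) : ℝ) = ∑ n ∈ Finset.Ico m i, (lam n : ℝ) := by
      rw [Finset.sum_Ico_eq_sum_range]
      simp only [add_comm]
    have h3 : ∑ n ∈ Finset.Ico m i, (lam n : ℝ) ≤ ∑ n ∈ Finset.Ico m (N - 1), (lam n : ℝ) :=
      Finset.sum_le_sum_of_subset_of_nonneg (Finset.Ico_subset_Ico_right hi.2.le)
        fun _ _ _ => NNReal.coe_nonneg _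
    have h4 : (0 : ℝ) ≤ ω * lam (N - 1) := by positivity
    rw [hD]
    linarith
  have hcard : ((Finset.Ico m (N - 1)).card : ℝ) = (N : ℝ) - m - 1 := by
    rw [Nat.card_Ico, Nat.cast_sub (by omega), Nat.cast_sub (by omega)]
    push_cast
    ring
  have hsum := Finset.card_nsmul_le_sum _ _ _ key
  rw [nsmul_eq_mul, hcard, ← Finset.mul_sum] at hsum
  have h5 : ∑ n ∈ Finset.Ico m (N - 1), (lam n : ℝ) ≤ Γ * lam 0 := by
    have h6 : ∑ n ∈ Finset.Ico m (N - 1), lam n ≤ Γ * lam 0 :=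
      (Finset.sum_le_sum_of_subset (Finset.Ico_subset_Ico_left m.zero_le)).trans
        (le_self_add.trans h0)
    exact_mod_cast h6
  calc _ ≤ (Γ : ℝ) * ∑ n ∈ Finset.Ico m (N - 1), (lam n : ℝ) := hsum
    _ ≤ Γ * (Γ * lam 0) := by gcongr
    _ = _ := by ring

/-- No positivity of `lam` or `ν` is required, so this also covers stage costs, which may vanish and
so need not be `Feasible`. -/
theorem sub_tail_le (hm : m + 2 ≤ N)
    (h0 : ∑ n ∈ Finset.Ico 0 (N - 1), lam n + ω * lam (N - 1) ≤ Γ * lam 0)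
    (hν : ∀ j, j + m + 1 ≤ N → ν ≤ ∑ n ∈ Finset.range j, lam (n + m) + Γ * lam (j + m)) :
    (ν - (∑ n ∈ Finset.Ico m (N - 1), (lam n : ℝ) + ω * lam (N - 1))) ≤
      (Γ : ℝ) ^ 2 / ((N : ℝ) - m - 1) * lam 0 := by
  have hpos : (0 : ℝ) < (N : ℝ) - m - 1 := by
    have : ((m + 2 : ℕ) : ℝ) ≤ N := by exact_mod_cast hm
    push_cast at this
    linarith
  rw [div_mul_eq_mul_div, le_div_iff₀ hpos, mul_comm]
  exact mul_sub_tail_le hm h0 hν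

theorem sum_range_eq_add_tail (hm : m + 1 ≤ N) (lam : ℕ → ℝ≥0) :
    ∑ n ∈ Finset.range (N - 1), (lam n : ℝ) =
      ∑ n ∈ Finset.range m, (lam n : ℝ) + ∑ n ∈ Finset.Ico m (N - 1), (lam n : ℝ) :=
  (Finset.sum_range_add_sum_Ico _ (by omega)).symm

theorem le_alphaOpt (hB : ∀ k r, B β ω k r ≤ Γ * r) (hm : 1 ≤ m) (hN : m + 2 ≤ N) :
    ((1 - (Γ : ℝ) ^ 2 / ((N : ℝ) - m - 1) : ℝ) : EReal) ≤ alphaOpt β ω N m := by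
  refine le_iInf fun lam => le_iInf fun ν => le_iInf fun h => ?_
  obtain ⟨hpos, -, hk, hj⟩ := h
  have hl0 : (0 : ℝ) < lam 0 := hpos 0 (by omega)
  have hS : (lam 0 : ℝ) ≤ ∑ n ∈ Finset.range m, (lam n : ℝ) :=
    Finset.single_le_sum (f := fun n => (lam n : ℝ)) (fun _ _ => NNReal.coe_nonneg _)
      (Finset.mem_range.2 hm)
  have hD := sub_tail_le hN ((hk 0 (by omega)).trans (hB _ _))
    (fun j hjN => (hj j hjN).trans (by gcongr; exact hB _ _))
  have hE : (0 : ℝ) ≤ (Γ : ℝ) ^ 2 / ((N : ℝ) - m - 1) := by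
    have : ((m + 2 : ℕ) : ℝ) ≤ N := by exact_mod_cast hN
    push_cast at this
    exact div_nonneg (by positivity) (by linarith)
  rw [EReal.coe_le_coe_iff, le_div_iff₀ (hl0.trans_le hS),
    sum_range_eq_add_tail (m := m) (by omega) lam]
  have := mul_le_mul_of_nonneg_left hS hE
  linarith

/-- The sequences `λ_n = δ ^ n` with small `δ` show that the optimal value is at most one. -/
theorem alphaOpt_le_one {c : ℕ → ℝ≥0} (hc : ∀ (r : ℝ≥0) (n : ℕ), β r n = c n * r)
    (hB : ∀ k, 2 ≤ k → 1 < B β ω k 1) (hm : 1 ≤ m) (hN : m + 1 ≤ N) :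
    alphaOpt β ω N m ≤ 1 := by
  refine EReal.le_of_forall_lt_iff_le.1 fun z hz => ?_
  have hz1 : 1 < z := by exact_mod_cast hz
  -- `(N + ω) δ` will dominate the tails relative to their preceding term: being at most `z - 1`
  -- controls the objective, being at most `B_k(1) - 1` for the finitely many `k ≤ N` gives
  -- feasibility.
  obtain ⟨δ, hδ0, hδ1, hδz, hδB⟩ : ∃ δ : ℝ≥0, 0 < δ ∧ δ ≤ 1 ∧ ((N + ω) * δ : ℝ) ≤ z - 1 ∧
      ∀ k ∈ Finset.Icc 2 N, 1 + (N + ω) * δ ≤ B β ω k 1 := by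
    have ht : Tendsto (fun δ : ℝ≥0 => (N + ω) * δ) (𝓝[>] 0) (𝓝 0) := by
      have : Tendsto (fun δ : ℝ≥0 => (N + ω) * δ) (𝓝 0) (𝓝 ((N + ω) * 0)) :=
        (continuous_const.mul continuous_id).tendsto 0
      rw [mul_zero] at this
      exact this.mono_left nhdsWithin_le_nhds
    have h1 : ∀ᶠ δ : ℝ≥0 in 𝓝[>] 0, δ ≤ 1 :=
      nhdsWithin_le_nhds (Iic_mem_nhds zero_lt_one)
    have h2 : ∀ᶠ δ : ℝ≥0 in 𝓝[>] 0, ((N + ω) * δ : ℝ) ≤ z - 1 := by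
      have h3 : (0 : ℝ≥0) < (z - 1).toNNReal := by simpa using hz1
      filter_upwards [ht.eventually (Iic_mem_nhds h3)] with δ hδ
      have := (Real.le_toNNReal_iff_coe_le (by linarith)).1 hδ
      exact_mod_cast this
    have h3 : ∀ᶠ δ : ℝ≥0 in 𝓝[>] 0, ∀ k ∈ Finset.Icc 2 N, 1 + (N + ω) * δ ≤ B β ω k 1 := by
      rw [Filter.eventually_all_finset]
      intro k hk
      have h4 : Tendsto (fun δ : ℝ≥0 => 1 + (N + ω) * δ) (𝓝[>] 0) (𝓝 (1 + 0)) :=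
        tendsto_const_nhds.add ht
      rw [add_zero] at h4
      exact h4.eventually (Iic_mem_nhds (hB k (Finset.mem_Icc.1 hk).1))
    obtain ⟨δ, ⟨⟨h1, h2⟩, h3⟩, h4⟩ := (((h1.and h2).and h3).and self_mem_nhdsWithin).exists
    exact ⟨δ, h4, h1, h2, h3⟩
  have htail : ∀ k, k + 1 ≤ N - 1 →
      ∑ n ∈ Finset.Ico (k + 1) (N - 1), δ ^ n + ω * δ ^ (N - 1) ≤ (N + ω) * δ ^ (k + 1) := by
    intro k hk
    rw [add_mul]
    refine add_le_add ?_ (mul_le_mul' le_rfl (pow_le_pow_of_le_one zero_le hδ1 hk))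
    refine (Finset.sum_le_card_nsmul _ _ (δ ^ (k + 1)) fun n hn => ?_).trans ?_
    · exact pow_le_pow_of_le_one zero_le hδ1 (Finset.mem_Ico.1 hn).1
    · rw [nsmul_eq_mul, Nat.card_Ico]
      gcongr
      omega
  have hfeas : Feasible β ω N m (fun n => δ ^ n) (δ ^ N) := by
    refine ⟨fun n _ => pow_pos hδ0 n, pow_pos hδ0 N, fun k hk => ?_, fun j hj => ?_⟩
    · have h1 := htail k (by omega)
      rw [Finset.sum_eq_sum_Ico_succ_bot (by omega), B_eq_mul hc, add_assoc]
      calc _ ≤ δ ^ k + (N + ω) * δ ^ (k + 1) := by gcongr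
        _ = (1 + (N + ω) * δ) * δ ^ k := by ring
        _ ≤ _ := by
          gcongr
          exact hδB _ (Finset.mem_Icc.2 (by omega))
    · rw [B_eq_mul hc]
      calc δ ^ N ≤ δ ^ (j + m) := pow_le_pow_of_le_one zero_le hδ1 (by omega)
        _ ≤ B β ω (N - j) 1 * δ ^ (j + m) := le_mul_of_one_le_left zero_le (hB _ (by omega)).le
        _ ≤ _ := le_add_self
  refine iInf_le_of_le (fun n => δ ^ n) (iInf_le_of_le (δ ^ N) (iInf_le_of_le hfeas ?_))
  have hS : (1 : ℝ) ≤ ∑ n ∈ Finset.range m, (δ ^ n : ℝ) := by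
    simpa using Finset.single_le_sum (f := fun n => (δ ^ n : ℝ)) (fun _ _ => by positivity)
      (Finset.mem_range.2 hm)
  have hT : (∑ n ∈ Finset.Ico m (N - 1), (δ ^ n : ℝ) + ω * δ ^ (N - 1)) ≤ z - 1 := by
    have h1 := htail (m - 1) (by omega)
    rw [Nat.sub_add_cancel hm] at h1
    have h2 : (N + ω) * δ ^ m ≤ (N + ω) * δ := by
      gcongr
      exact (pow_le_pow_of_le_one zero_le hδ1 hm).trans_eq (pow_one δ)
    refine le_trans ?_ hδz
    exact_mod_cast h1.trans h2
  rw [EReal.coe_le_coe_iff, sum_range_eq_add_tail hN, div_le_iff₀ (by push_cast; linarith)]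
  push_cast
  have h5 : (0 : ℝ) ≤ δ ^ N := by positivity
  -- With `S ≥ 1` the sum of the first `m` terms, the numerator is at most `S + (z - 1) ≤ z S`.
  nlinarith

theorem tendsto_sq_div_sub (Γ : ℝ) (m : ℕ) :
    Tendsto (fun N : ℕ => Γ ^ 2 / ((N : ℝ) - m - 1)) atTop (𝓝 0) := by
  refine Tendsto.const_div_atTop ?_ _
  simp only [sub_eq_add_neg]
  exact (tendsto_natCast_atTop_atTop.atTop_add tendsto_const_nhds).atTop_add tendsto_const_nhds

theorem tendsto_alphaOpt {c : ℕ → ℝ≥0} (hc : ∀ (r : ℝ≥0) (n : ℕ), β r n = c n * r)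
    (hΓ : ∀ k r, B β ω k r ≤ Γ * r) (hB : ∀ k, 2 ≤ k → 1 < B β ω k 1) (hm : 1 ≤ m) :
    Tendsto (fun N : ℕ => alphaOpt β ω N m) atTop (𝓝 1) := by
  have h : Tendsto (fun N : ℕ => ((1 - (Γ : ℝ) ^ 2 / ((N : ℝ) - m - 1) : ℝ) : EReal)) atTop
      (𝓝 1) := by
    have := (tendsto_const_nhds (x := (1 : ℝ))).sub (tendsto_sq_div_sub Γ m)
    rw [sub_zero] at this
    exact (continuous_coe_real_ereal.tendsto 1).comp this
  refine tendsto_of_tendsto_of_tendsto_of_le_of_le' h tendsto_const_nhds ?_ ?_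
  · filter_upwards [eventually_ge_atTop (m + 2)] with N hN using le_alphaOpt hΓ hm hN
  · filter_upwards [eventually_ge_atTop (m + 1)] with N hN using alphaOpt_le_one hc hB hm hN

end OptimizationProblem

end MPC

namespace MPC

/-! ### Decrease of the optimal cost along trajectories -/

section Dynamics

variable {X U : Type*} {f : X → U → X} {l : X → U → ℝ≥0}

theorem lstar_le (l : X → U → ℝ≥0) (x : X) (u : U) : lstar l x ≤ l x u :=
  ciInf_le' _ _

theorem traj_congr {u v : ℕ → U} {x : X} :
    ∀ {n : ℕ}, (∀ i < n, u i = v i) → traj f u x n = traj f v x n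
  | 0, _ => rfl
  | n + 1, h => by
    rw [traj, traj, traj_congr fun i hi => h i (hi.trans n.lt_succ_self), h n n.lt_succ_self]

theorem traj_add (u : ℕ → U) (x : X) (k : ℕ) :
    ∀ n, traj f u x (k + n) = traj f (fun i => u (k + i)) (traj f u x k) n
  | 0 => rfl
  | n + 1 => by rw [← add_assoc, traj, traj, traj_add u x k n]

theorem cost_eq_add {N k : ℕ} (hk : k + 1 ≤ N) (ω : ℝ≥0) (x : X) (u : ℕ → U) :
    cost f l ω N x u = ∑ n ∈ Finset.range k, l (traj f u x n) (u n) +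
      cost f l ω (N - k) (traj f u x k) fun i => u (k + i) := by
  have h : N - 1 = k + (N - k - 1) := by omega
  simp only [cost, ← traj_add]
  rw [h, Finset.sum_range_add, add_assoc]

/-- Following a control sequence for `k` steps and then switching to a controllability sequence
gives an upper bound for the minimal cost. -/
theorem cost_minimizer_le {β : ℝ≥0 → ℝ≥0 → ℝ≥0} {ω : ℝ≥0} {N k : ℕ} {x : X} {ustar : ℕ → U}
    (hctr : Controllable f l β) (hmin : ∀ u, cost f l ω N x ustar ≤ cost f l ω N x u)
    (u : ℕ → U) (hk : k + 1 ≤ N) :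
    cost f l ω N x ustar ≤ ∑ n ∈ Finset.range k, l (traj f u x n) (u n) +
      B β ω (N - k) (lstar l (traj f u x k)) := by
  obtain ⟨w, hw⟩ := hctr (traj f u x k)
  set z : ℕ → U := fun n => if n < k then u n else w (n - k) with hz
  have hzu : ∀ n < k, z n = u n := fun n hn => if_pos hn
  have htr : ∀ n ≤ k, traj f z x n = traj f u x n := fun n hn =>
    traj_congr fun i hi => hzu i (hi.trans_le hn)
  have hzw : (fun i => z (k + i)) = w := by
    funext i
    simp [hz]
  refine (hmin z).trans ?_
  rw [cost_eq_add hk, hzw, htr k le_rfl]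
  refine add_le_add (Finset.sum_le_sum fun n hn => ?_) ?_
  · rw [Finset.mem_range] at hn
    rw [htr n hn.le, hzu n hn]
  · unfold cost B
    gcongr with n
    · exact hw n
    · exact hw _

theorem stage_le_cost {ω : ℝ≥0} {N p : ℕ} (hp : p + 2 ≤ N) (x : X) (u : ℕ → U) :
    l (traj f u x p) (u p) ≤ cost f l ω N x u :=
  (Finset.single_le_sum (f := fun n => l (traj f u x n) (u n)) (fun _ _ => zero_le)
    (Finset.mem_range.2 (by omega))).trans le_self_add

/-- Relaxed dynamic programming inequality. -/
theorem cost_decrease {β : ℝ≥0 → ℝ≥0 → ℝ≥0} {ω Γ : ℝ≥0} {N m : ℕ} {x : X} {u v : ℕ → U}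
    (hctr : Controllable f l β) (hΓ : ∀ k r, B β ω k r ≤ Γ * r)
    (hm : 1 ≤ m) (hN : m + 2 ≤ N) (hε : (Γ : ℝ) ^ 2 / ((N : ℝ) - m - 1) ≤ 1 / 2)
    (hu : ∀ w, cost f l ω N x u ≤ cost f l ω N x w)
    (hv : ∀ w, cost f l ω N (traj f u x m) v ≤ cost f l ω N (traj f u x m) w) :
    (cost f l ω N (traj f u x m) v : ℝ) ≤ cost f l ω N x u - 1 / 2 * l x (u 0) := by
  set lam : ℕ → ℝ≥0 := fun n => l (traj f u x n) (u n) with hlam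
  have hB : ∀ i k, B β ω k (lstar l (traj f u x i)) ≤ Γ * lam i := fun i k =>
    (hΓ _ _).trans (by gcongr; exact lstar_le _ _ _)
  have h0 : ∑ n ∈ Finset.Ico 0 (N - 1), lam n + ω * lam (N - 1) ≤ Γ * lam 0 := by
    rw [← Finset.range_eq_Ico]
    refine (cost_minimizer_le (k := 0) hctr hu u (by omega)).trans ?_
    simpa using hB 0 N
  -- The competitor to `v` continues along `u` for `j` more steps, then switches to a
  -- controllability sequence.
  have hν : ∀ j, j + m + 1 ≤ N → cost f l ω N (traj f u x m) v ≤
      ∑ n ∈ Finset.range j, lam (n + m) + Γ * lam (j + m) := by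
    intro j hj
    refine (cost_minimizer_le hctr hv (fun i => u (m + i)) (k := j) (by omega)).trans ?_
    simp only [← traj_add, hlam, add_comm _ m]
    gcongr
    exact hB _ _
  have hD := sub_tail_le hN h0 hν
  have hS : (lam 0 : ℝ) ≤ ∑ n ∈ Finset.range m, (lam n : ℝ) :=
    Finset.single_le_sum (f := fun n => (lam n : ℝ)) (fun _ _ => NNReal.coe_nonneg _)
      (Finset.mem_range.2 hm)
  have hcost : (cost f l ω N x u : ℝ) =
      ∑ n ∈ Finset.range (N - 1), (lam n : ℝ) + ω * lam (N - 1) := by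
    simp [cost, hlam]
  rw [sum_range_eq_add_tail (m := m) (by omega) lam] at hcost
  have h1 := mul_le_mul_of_nonneg_right hε (lam 0).coe_nonneg
  have h2 : lam 0 = l x (u 0) := rfl
  rw [← h2]
  linarith

end Dynamics

/-! ### Transmission times and the closed loop -/

section TransmissionTimes

variable {m : ℕ → ℕ}

theorem sigma_succ (m : ℕ → ℕ) (k : ℕ) : sigma m (k + 1) = sigma m k + m k :=
  Finset.sum_range_succ _ _

theorem sigma_mono (m : ℕ → ℕ) : Monotone (sigma m) :=
  monotone_nat_of_le_succ fun k => by rw [sigma_succ]; omega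

theorem phi_sigma_add {k p : ℕ} (hp : p < m k) : phi m (sigma m k + p) = sigma m k := by
  refine IsGreatest.csSup_eq ⟨⟨⟨k, rfl⟩, le_self_add⟩, ?_⟩
  rintro s ⟨⟨i, rfl⟩, hi⟩
  refine sigma_mono m (not_lt.1 fun hik => ?_)
  have := sigma_mono m (Nat.succ_le_of_lt hik)
  rw [Nat.succ_eq_add_one, sigma_succ] at this
  omega

theorem exists_sigma_add (hm : ∀ i, 1 ≤ m i) (n : ℕ) : ∃ k p, p < m k ∧ n = sigma m k + p := by
  induction n with
  | zero => exact ⟨0, 0, hm 0, by simp [sigma]⟩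
  | succ n ih =>
    obtain ⟨k, p, hp, rfl⟩ := ih
    by_cases h : p + 1 < m k
    · exact ⟨k, p + 1, h, rfl⟩
    · exact ⟨k + 1, 0, hm _, by rw [sigma_succ]; omega⟩

theorem sigma_le_mul {b : ℕ} (hm : ∀ i, m i ≤ b) (k : ℕ) : sigma m k ≤ b * k := by
  rw [mul_comm]
  simpa [sigma] using Finset.sum_le_card_nsmul (Finset.range k) m b fun i _ => hm i

/-- Within a block the feedback runs in open loop. The endpoint `p = m k` is included because
reaching it uses only controls of index below `m k`. -/
theorem closedLoop_eq_traj {X U : Type*} {f : X → U → X} {μ : X → ℕ → U} {x : ℕ → X}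
    (hx : IsClosedLoop f μ m x) (k : ℕ) :
    ∀ {p : ℕ}, p ≤ m k → x (sigma m k + p) = traj f (μ (x (sigma m k))) (x (sigma m k)) p
  | 0, _ => rfl
  | p + 1, hp => by
    rw [← add_assoc, hx, phi_sigma_add hp, closedLoop_eq_traj hx k (Nat.le_of_succ_le hp), traj,
      Nat.add_sub_cancel_left]

end TransmissionTimes

/-! ### `K_∞`-functions as order automorphisms of `ℝ≥0` -/

section ComparisonFunctions

theorem IsKInfty.surjective {ρ : ℝ≥0 → ℝ≥0} (h : IsKInfty ρ) : Function.Surjective ρ := by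
  intro y
  obtain ⟨hc, h0, -, hb⟩ := h
  obtain ⟨_, ⟨b, rfl⟩, hb⟩ := not_bddAbove_iff.1 hb y
  obtain ⟨x, -, hx⟩ := intermediate_value_Icc (zero_le (a := b)) hc.continuousOn
    ⟨h0.trans_le zero_le, hb.le⟩
  exact ⟨x, hx⟩

theorem isKInfty_of_orderIso (e : ℝ≥0 ≃o ℝ≥0) : IsKInfty e := by
  refine ⟨e.continuous, e.map_bot, e.strictMono, ?_⟩
  rw [e.surjective.range_eq]
  exact not_bddAbove_univ

noncomputable def IsKInfty.orderIso {ρ : ℝ≥0 → ℝ≥0} (h : IsKInfty ρ) : ℝ≥0 ≃o ℝ≥0 :=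
  h.2.2.1.orderIsoOfSurjective ρ h.surjective

@[simp] theorem IsKInfty.orderIso_apply {ρ : ℝ≥0 → ℝ≥0} (h : IsKInfty ρ) (r : ℝ≥0) :
    h.orderIso r = ρ r := rfl

/-- Conjugating an exponential decay by `K_∞`-functions gives a `KL_0`-function. -/
theorem isKL0_exp_decay (e₁ e₂ : ℝ≥0 ≃o ℝ≥0) {K θ : ℝ≥0} (hK : 0 < K) (hθ0 : 0 < θ)
    (hθ1 : θ < 1) : IsKL0 fun r t => e₁ (K * θ ^ (t : ℝ) * e₂ r) := by
  refine ⟨?_, fun r _ => ?_, fun t => Or.inl ?_⟩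
  · refine e₁.continuous.comp ((continuous_const.mul ?_).mul (e₂.continuous.comp continuous_fst))
    exact continuous_iff_continuousAt.2 fun p => continuousAt_const.nnrpow
      (NNReal.continuous_coe.comp continuous_snd).continuousAt (Or.inl hθ0.ne')
  · have h1 : Tendsto (fun t : ℝ≥0 => θ ^ (t : ℝ)) atTop (𝓝 0) := by
      rw [← NNReal.tendsto_coe]
      simp only [NNReal.coe_rpow, NNReal.coe_zero]
      exact (tendsto_rpow_atTop_of_base_lt_one (θ : ℝ)
        (by have := θ.coe_nonneg; linarith) (by exact_mod_cast hθ1)).comp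
        (NNReal.tendsto_coe_atTop.2 tendsto_id)
    have h2 : Tendsto (fun t : ℝ≥0 => K * θ ^ (t : ℝ) * e₂ r) atTop (𝓝 (K * 0 * e₂ r)) :=
      (h1.const_mul K).mul_const _
    have h3 := (e₁.continuous.tendsto _).comp h2
    rw [mul_zero, zero_mul, show e₁ 0 = 0 from e₁.map_bot] at h3
    exact h3
  · have hpos : 0 < K * θ ^ (t : ℝ) := mul_pos hK (NNReal.rpow_pos hθ0)
    exact isKInfty_of_orderIso ((e₂.trans (OrderIso.mulLeft₀ _ hpos)).trans e₁)

end ComparisonFunctions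

/-- Stability of the closed loop under an exponential bound on `l⋆`. -/
theorem asymptoticallyStabilizes_of_lstar_le {X U : Type*} [MetricSpace X] {f : X → U → X}
    {l : X → U → ℝ≥0} {A : Set X} {μ : X → ℕ → U} {M : Set ℕ} (hA : TargetSet f l A)
    {K θ : ℝ≥0} (hK : 0 < K) (hθ0 : 0 < θ) (hθ1 : θ < 1)
    (h : ∀ m : ℕ → ℕ, (∀ i, m i ∈ M) → ∀ x : ℕ → X, IsClosedLoop f μ m x →
      ∀ n : ℕ, lstar l (x n) ≤ K * θ ^ n * lstar l (x 0)) :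
    AsymptoticallyStabilizes f μ M A := by
  obtain ⟨-, -, -, α₁, α₂, h₁, h₂, hα⟩ := hA
  -- The bound is `α₁⁻¹(K θ^t α₂(r))`.
  refine ⟨_, isKL0_exp_decay h₁.orderIso.symm h₂.orderIso hK hθ0 hθ1, fun m hm x hx n => ?_⟩
  rw [OrderIso.le_symm_apply, h₁.orderIso_apply, h₂.orderIso_apply, NNReal.coe_natCast,
    NNReal.rpow_natCast]
  calc _ ≤ lstar l (x n) := (hα _).1
    _ ≤ K * θ ^ n * lstar l (x 0) := h m hm x hx n
    _ ≤ _ := by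
      gcongr
      exact (hα _).2

/-- Multistep MPC with a sufficiently long optimization horizon is stabilizing. -/
theorem asymptoticallyStabilizes_of_isMPCFeedback {X U : Type*} [MetricSpace X] {f : X → U → X}
    {l : X → U → ℝ≥0} {A : Set X} {β : ℝ≥0 → ℝ≥0 → ℝ≥0} {ω Γ : ℝ≥0} {N mstar : ℕ}
    {μ : X → ℕ → U} {M : Set ℕ} (hctr : Controllable f l β) (hA : TargetSet f l A)
    (hμ : IsMPCFeedback f l ω N mstar μ) (hΓ1 : 1 ≤ Γ) (hΓ : ∀ k r, B β ω k r ≤ Γ * r)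
    (hmstar : 1 ≤ mstar) (hM : M ⊆ Set.Icc 1 mstar) (hN : mstar + 2 ≤ N)
    (hε : ∀ m ∈ M, (Γ : ℝ) ^ 2 / ((N : ℝ) - m - 1) ≤ 1 / 2) :
    AsymptoticallyStabilizes f μ M A := by
  choose us hmin hus using hμ
  set V : X → ℝ≥0 := fun y => cost f l ω N y (us y) with hV
  have hΓ0 : (1 : ℝ) ≤ Γ := by exact_mod_cast hΓ1
  have hVle : ∀ y, V y ≤ Γ * lstar l y := fun y => by
    refine (cost_minimizer_le (k := 0) hctr (hmin y) (us y) (by omega)).trans ?_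
    simpa [traj] using hΓ N (lstar l y)
  -- Over a block `V` drops by at least half the first stage cost, which is at least `V / (2Γ)`.
  obtain ⟨q, hq⟩ : ∃ q : ℝ≥0, (q : ℝ) = 1 - 1 / (2 * Γ) := by
    refine ⟨⟨1 - 1 / (2 * Γ), ?_⟩, rfl⟩
    rw [sub_nonneg, div_le_one (by linarith)]
    linarith
  have hq0 : 0 < q := by
    rw [← NNReal.coe_pos, hq, sub_pos, div_lt_one (by linarith)]
    linarith
  have hq1 : q < 1 := by
    rw [← NNReal.coe_lt_coe, hq, NNReal.coe_one]
    have : (0 : ℝ) < 1 / (2 * Γ) := by positivity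
    linarith
  have hdec : ∀ y, ∀ m ∈ M, V (traj f (us y) y m) ≤ q * V y := by
    intro y m hmM
    have h1 := cost_decrease hctr hΓ (hM hmM).1 (by have := (hM hmM).2; omega) (hε m hmM)
      (hmin y) (hmin (traj f (us y) y m))
    have h2 : (V y : ℝ) ≤ Γ * l y (us y 0) := by
      exact_mod_cast (hVle y).trans (by gcongr; exact lstar_le _ _ _)
    have h3 : (V y : ℝ) / (2 * Γ) ≤ 1 / 2 * l y (us y 0) := by
      rw [div_le_iff₀ (by linarith)]
      linarith
    rw [← NNReal.coe_le_coe, NNReal.coe_mul, hq]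
    have h4 : (1 - 1 / (2 * Γ)) * (V y : ℝ) = V y - V y / (2 * Γ) := by ring
    rw [h4]
    linarith
  have hms : (mstar : ℝ) ≠ 0 := by exact_mod_cast (by omega : mstar ≠ 0)
  -- A factor `q` per block of at most `mstar` steps becomes a rate per step; the unfinished block
  -- costs the extra `q⁻¹` in `K`.
  set θ : ℝ≥0 := q ^ (1 / (mstar : ℝ)) with hθ
  have hθ0 : 0 < θ := NNReal.rpow_pos hq0
  have hθ1 : θ < 1 := NNReal.rpow_lt_one hq1 (by positivity)
  have hθq : θ ^ mstar = q := by
    rw [hθ, ← NNReal.rpow_natCast, ← NNReal.rpow_mul, one_div_mul_cancel hms, NNReal.rpow_one]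
  refine asymptoticallyStabilizes_of_lstar_le (K := q⁻¹ * Γ) hA
    (mul_pos (inv_pos.2 hq0) (zero_lt_one.trans_le hΓ1)) hθ0 hθ1 fun m hm x hx n => ?_
  have hm1 : ∀ i, 1 ≤ m i := fun i => (hM (hm i)).1
  have hm2 : ∀ i, m i ≤ mstar := fun i => (hM (hm i)).2
  have htraj : ∀ k p, p ≤ m k →
      x (sigma m k + p) = traj f (us (x (sigma m k))) (x (sigma m k)) p := fun k p hp =>
    (closedLoop_eq_traj hx k hp).trans
      (traj_congr fun i hi => hus _ i ((hi.trans_le hp).trans_le (hm2 k)))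
  have hVk : ∀ k, V (x (sigma m k)) ≤ q ^ k * V (x 0) := by
    intro k
    induction k with
    | zero => simp [sigma]
    | succ k ih =>
      rw [sigma_succ, htraj k _ le_rfl, pow_succ', mul_assoc]
      exact (hdec _ _ (hm k)).trans (by gcongr)
  obtain ⟨k, p, hp, rfl⟩ := exists_sigma_add hm1 n
  have hn : sigma m k + p ≤ mstar * (k + 1) := by
    have h1 := sigma_le_mul hm2 (k + 1)
    rw [sigma_succ] at h1
    omega
  have hqk : q ^ k ≤ q⁻¹ * θ ^ (sigma m k + p) := by
    rw [le_inv_mul_iff₀ hq0, ← pow_succ', ← hθq, ← pow_mul]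
    exact pow_le_pow_of_le_one zero_le hθ1.le hn
  calc lstar l (x (sigma m k + p)) ≤ V (x (sigma m k)) := by
        rw [htraj k p hp.le]
        exact (lstar_le _ _ _).trans (stage_le_cost (by have := hm2 k; omega) _ _)
    _ ≤ q ^ k * V (x 0) := hVk k
    _ ≤ (q⁻¹ * θ ^ (sigma m k + p)) * (Γ * lstar l (x 0)) := by
      gcongr
      exact hVle _
    _ = _ := by ring

end MPC

theorem corollary6p1 (β : ℝ≥0 → ℝ≥0 → ℝ≥0) (hβ : MPC.IsKL0 β) (ω : ℝ≥0) (hω : 1 ≤ ω) :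
    ((MPC.IsExponential β ∨ (MPC.IsFiniteTime β ∧ ∀ k : ℕ, 2 ≤ k → 1 < MPC.B β ω k 1)) →
      ∀ m : ℕ, 1 ≤ m → Tendsto (fun N : ℕ => MPC.alphaOpt β ω N m) atTop (𝓝 1)) ∧
    ((MPC.IsExponential β ∨ MPC.IsFiniteTime β) →
      ∀ mstar : ℕ, 1 ≤ mstar → ∀ M : Set ℕ, M ⊆ Set.Icc 1 mstar →
        ∃ N₀ : ℕ, ∀ N : ℕ, N₀ ≤ N →
          mstar + 1 ≤ N ∧
          (∀ m ∈ M, 0 < MPC.alphaOpt β ω N m) ∧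
          ∀ (X : Type u) (U : Type v) [MetricSpace X] [MetricSpace U]
            (f : X → U → X) (l : X → U → ℝ≥0) (A : Set X),
            MPC.Controllable f l β → MPC.TargetSet f l A →
            ∀ μ : X → ℕ → U, MPC.IsMPCFeedback f l ω N mstar μ →
              MPC.AsymptoticallyStabilizes f μ M A) := by
  refine ⟨fun h m hm => ?_, fun h mstar hmstar M hM => ?_⟩
  · have h' : MPC.IsExponential β ∨ MPC.IsFiniteTime β := h.imp_right And.left
    obtain ⟨c, -, hc⟩ := MPC.exists_summable_linear h'
    obtain ⟨Γ, -, hΓ⟩ := MPC.exists_B_le h' ω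
    refine MPC.tendsto_alphaOpt hc hΓ (fun k hk => ?_) hm
    exact h.elim (fun he => MPC.one_lt_B_of_isExponential he hω hk) fun hf => hf.2 k hk
  · obtain ⟨Γ, hΓ1, hΓ⟩ := MPC.exists_B_le h ω
    -- Only finitely many `m` occur, so one threshold, independent of the system, serves them all.
    have hev : ∀ᶠ N : ℕ in atTop, ∀ m ∈ Finset.Icc 1 mstar,
        (Γ : ℝ) ^ 2 / ((N : ℝ) - m - 1) ≤ 1 / 2 := by
      rw [Filter.eventually_all_finset]
      exact fun m _ => (MPC.tendsto_sq_div_sub Γ m).eventually (Iic_mem_nhds one_half_pos)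
    obtain ⟨N₀, hN₀⟩ := eventually_atTop.1 (hev.and (eventually_ge_atTop (mstar + 2)))
    refine ⟨N₀, fun N hN => ?_⟩
    obtain ⟨hε, hN2⟩ := hN₀ N hN
    have hεM : ∀ m ∈ M, (Γ : ℝ) ^ 2 / ((N : ℝ) - m - 1) ≤ 1 / 2 := fun m hm =>
      hε m (Finset.mem_Icc.2 (hM hm))
    refine ⟨by omega, fun m hm => ?_, fun X U _ _ f l A hctr hA μ hμ =>
      MPC.asymptoticallyStabilizes_of_isMPCFeedback hctr hA hμ hΓ1 hΓ hmstar hM hN2 hεM⟩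
    refine lt_of_lt_of_le ?_ (MPC.le_alphaOpt hΓ (hM hm).1 (by have := (hM hm).2; omega))
    have := hεM m hm
    exact_mod_cast (by linarith : (0 : ℝ) < 1 - (Γ : ℝ) ^ 2 / ((N : ℝ) - m - 1))
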